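/- Let $K\ge 1$, $\mathcal X=\{1,\dots,K\}$, and let $\mathcal X^*$ be the set of all finite words over $\mathcal X$. Let $\mathcal S\subseteq\mathcal X^*$ be a finite-type constraint, i.e. there is a finite set $\mathcal F\subset\mathcal X^*$ such that $\mathcal S$ consists of all words that contain no element of $\mathcal F$ as a contiguous subword. Assume that $\mathcal S$ contains a non-empty word and is irreducible: for all $u,v\in\mathcal S$ there is $w\in\mathcal S$ with $uwv\in\mathcal S$. Let $E=(E_n)_{n\in\mathbb Z}$ be a stationary ergodic process with values in $\{0,1\}$ and erasure rate $\varepsilon=P(E_1=0)$. For a stationary process $X=(X_n)_{n\in\mathbb Z}$ with values in $\mathcal X$, independent of $E$, let $Y_n=X_nE_n$ be the output of the erasure channel, and let $$I(X;Y)=\lim_{n\to\infty}\frac1n I(X_1,\dots,X_n;Y_1,\dots,Y_n)$$ be the mutual information rate (in nats). Let $$C(\mathcal S,\varepsilon)=\sup_X I(X;Y),$$ where the supremum is over all stationary processes $X$ supported on $\mathcal S$, i.e. such that every finite word occurring in $X$ with positive probability belongs to $\mathcal S$. (The capacity depends on the law of $E$; $C(\mathcal S,0)$ is the capacity for an erasure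 process of erasure rate $0$, i.e. with $E_n=1$ almost surely for all $n$.) Then the limits above exist, the suprema defining $C(\mathcal S,\varepsilon)$ and $C(\mathcal S,0)$ are over non-empty bounded sets, and $$(1-\varepsilon)\,C(\mathcal S,0)\le C(\mathcal S,\varepsilon)\le(1-\varepsilon)\log K .$$ -/

import Mathlib

open MeasureTheory Filter Topology

noncomputable section

namespace ErasureChannel

/-! ### Constraints -/

/-- The input alphabet `{1, …, K}`. -/
abbrev Input (K : ℕ) : Type := Finset.Icc 1 K

/-- The finite-type constraint with forbidden set `F`: all finite words that contain no element
of `F` as a contiguous subword. -/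
def finiteTypeConstraint {α : Type*} (F : Finset (List α)) : Set (List α) :=
  {w | ∀ f ∈ F, ¬ f <:+: w}

def IsFiniteType {α : Type*} (S : Set (List α)) : Prop :=
  ∃ F : Finset (List α), S = finiteTypeConstraint F

def IsIrreducibleConstraint {α : Type*} (S : Set (List α)) : Prop :=
  ∀ u ∈ S, ∀ v ∈ S, ∃ w ∈ S, u ++ w ++ v ∈ S

/-! ### Stationary processes, given by their laws on the two-sided path space -/

/-- The shift on two-sided sequences. -/
def shift {α : Type*} (x : ℤ → α) : ℤ → α := fun n => x (n + 1)

/-- `w` is read off from `x` at the positions `i, i + 1, …, i + |w| - 1`. -/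
def ReadsAt {α : Type*} (x : ℤ → α) (i : ℤ) (w : List α) : Prop :=
  ∀ k : Fin w.length, x (i + (k : ℤ)) = w.get k

/-- The set of all finite words that the process with law `μ` produces with positive
probability. -/
def allowedWords {α : Type*} [MeasurableSpace α] (μ : Measure (ℤ → α)) : Set (List α) :=
  {w | ∃ i : ℤ, 0 < μ {x | ReadsAt x i w}}

/-- `μ` is the law of a stationary process supported on the constraint `S`. -/
structure IsAdmissibleInput {K : ℕ} (S : Set (List (Input K)))
    (μ : Measure (ℤ → Input K)) : Prop where
  prob : IsProbabilityMeasure μ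
  stationary : MeasurePreserving shift μ μ
  supported : allowedWords μ ⊆ S

/-- `ν` is the law of a binary stationary and ergodic process with `P(E₁ = 0) = ε`
(`Ergodic` includes invariance of `ν` under the shift). -/
structure IsErasureProcess (ν : Measure (ℤ → Fin 2)) (ε : ℝ) : Prop where
  prob : IsProbabilityMeasure ν
  ergodic : Ergodic shift ν
  rate : ν.real {e | e 1 = 0} = ε

/-! ### Entropy and mutual information of finite-valued random variables (in nats) -/

def entropy {Ω α : Type*} [MeasurableSpace Ω] [Fintype α] (P : Measure Ω) (Z : Ω → α) : ℝ :=
  ∑ a, Real.negMulLog (P.real (Z ⁻¹' {a}))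

def mutualInfo {Ω α β : Type*} [MeasurableSpace Ω] [Fintype α] [Fintype β]
    (P : Measure Ω) (Z : Ω → α) (W : Ω → β) : ℝ :=
  entropy P Z + entropy P W - entropy P (fun ω => (Z ω, W ω))

/-! ### The channel `Yₙ = Xₙ Eₙ` -/

/-- The product `x · e`, an element of the output alphabet `{0, …, K}`. -/
def erase {K : ℕ} (x : Input K) (e : Fin 2) : Fin (K + 1) :=
  ⟨(x : ℕ) * (e : ℕ), by
    have hx := (Finset.mem_Icc.mp x.2).2
    have he : (e : ℕ) ≤ 1 := by omega
    calc (x : ℕ) * (e : ℕ) ≤ K * 1 := Nat.mul_le_mul hx he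
      _ < K + 1 := by omega⟩

/-- The input block `X₁, …, Xₙ`, on the probability space of pairs (input, erasure). -/
def inputBlock {K : ℕ} (n : ℕ) (ω : (ℤ → Input K) × (ℤ → Fin 2)) : Fin n → Input K :=
  fun k => ω.1 ((k : ℤ) + 1)

/-- The output block `Y₁, …, Yₙ`. -/
def outputBlock {K : ℕ} (n : ℕ) (ω : (ℤ → Input K) × (ℤ → Fin 2)) : Fin n → Fin (K + 1) :=
  fun k => erase (ω.1 ((k : ℤ) + 1)) (ω.2 ((k : ℤ) + 1))

/-- `I(X₁, …, Xₙ; Y₁, …, Yₙ) / n`. The product measure expresses that the input and the erasure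
process are independent. -/
def blockRate {K : ℕ} (μ : Measure (ℤ → Input K)) (ν : Measure (ℤ → Fin 2)) (n : ℕ) : ℝ :=
  mutualInfo (μ.prod ν) (inputBlock n) (outputBlock n) / n

/-- The mutual information rate `I(X;Y) = lim I(X₁, …, Xₙ; Y₁, …, Yₙ) / n`. -/
def mutualInfoRate {K : ℕ} (μ : Measure (ℤ → Input K)) (ν : Measure (ℤ → Fin 2)) : ℝ :=
  limUnder atTop (blockRate μ ν)

/-- The rates achieved by stationary inputs supported on `S`. -/
def achievableRates {K : ℕ} (S : Set (List (Input K))) (ν : Measure (ℤ → Fin 2)) : Set ℝ :=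
  {r | ∃ μ, IsAdmissibleInput S μ ∧ r = mutualInfoRate μ ν}

/-- The capacity of the channel with erasure law `ν` and input constraint `S`. -/
def capacity {K : ℕ} (S : Set (List (Input K))) (ν : Measure (ℤ → Fin 2)) : ℝ :=
  sSup (achievableRates S ν)

/-- The limits and the supremum in the definition of the capacity are genuine: every mutual
information rate exists as a limit, and the set of rates is non-empty and bounded above. -/
structure CapacityWellDefined {K : ℕ} (S : Set (List (Input K)))
    (ν : Measure (ℤ → Fin 2)) : Prop where
  tendsto : ∀ μ, IsAdmissibleInput S μ →
    Tendsto (blockRate μ ν) atTop (𝓝 (mutualInfoRate μ ν))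
  nonempty : (achievableRates S ν).Nonempty
  bddAbove : BddAbove (achievableRates S ν)

end ErasureChannel

end

/-!
No input letter is `0`, so the output block reveals which letters are erased, and its mutual
information with the input block is the mean entropy of the unerased letters. An unerased letter
contributes at most `log K`, which gives the upper bound. For the lower bound, add the positions of
the block one at a time: by submodularity of entropy, a new letter that is not erased raises the
entropy of the unerased letters by at least as much as it raises the entropy of the whole block, so
the mean entropy of the unerased letters is at least `1 - ε` times the entropy of the block.

By stationarity and submodularity the mean entropies are subadditive in the block length, so
Fekete's lemma gives the limits. A random shift of a periodic sequence with period `uw`, where `u`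
is a long word of `S` and `uwu ∈ S`, is an admissible input.
-/

namespace ErasureChannel

open Real (log negMulLog)

section FiniteValued

variable {Ω α β : Type*} [MeasurableSpace Ω] [MeasurableSpace α] [MeasurableSingletonClass α]
  (P : Measure Ω) [IsFiniteMeasure P] {Z : Ω → α}

lemma ae_measureReal_fiber_pos [Countable α] (hZ : Measurable Z) :
    ∀ᵐ ω ∂P, 0 < P.real (Z ⁻¹' {Z ω}) := by
  refine ae_of_ae_map hZ.aemeasurable (p := fun a => 0 < P.real (Z ⁻¹' {a})) ?_
  refine ae_iff_of_countable.2 fun a ha => ?_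
  rw [Measure.map_apply hZ (measurableSet_singleton a)] at ha
  exact ENNReal.toReal_pos ha (measure_ne_top P _)

lemma integrable_comp_of_finite [Finite α] (hZ : Measurable Z) (f : α → ℝ) :
    Integrable (fun ω => f (Z ω)) P :=
  (Integrable.of_finite (μ := P.map Z)).comp_measurable hZ

lemma integral_comp_eq_sum [Fintype α] (hZ : Measurable Z) (f : α → ℝ) :
    ∫ ω, f (Z ω) ∂P = ∑ a, P.real (Z ⁻¹' {a}) * f a := by
  rw [← integral_map hZ.aemeasurable (measurable_of_finite f).aestronglyMeasurable,
    integral_fintype Integrable.of_finite]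
  simp_rw [map_measureReal_apply hZ (measurableSet_singleton _), smul_eq_mul]

lemma sum_measureReal_fiber [Fintype α] (hZ : Measurable Z) :
    ∑ a, P.real (Z ⁻¹' {a}) = P.real Set.univ := by
  simpa using sum_measureReal_preimage_singleton (μ := P) Finset.univ
    fun a _ => hZ (measurableSet_singleton a)

lemma sum_measureReal_prodMk_fiber [Fintype α] (hZ : Measurable Z) (W : Ω → β) (b : β) :
    ∑ a, P.real ((fun ω => (W ω, Z ω)) ⁻¹' {(b, a)}) = P.real (W ⁻¹' {b}) := by
  rw [← measureReal_restrict_apply_univ, ← sum_measureReal_fiber _ hZ]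
  refine Finset.sum_congr rfl fun a _ => ?_
  rw [measureReal_restrict_apply (hZ (measurableSet_singleton a)), Set.inter_comm,
    ← Set.singleton_prod_singleton, Set.mk_preimage_prod]

end FiniteValued

section Entropy

variable {Ω α β γ δ : Type*} [MeasurableSpace Ω]

/-- The surprisal `-log P(Z = Z(ω))` of the outcome `ω` for the random variable `Z`; its mean is
the entropy of `Z`. -/
noncomputable def surprisal (P : Measure Ω) (Z : Ω → α) (ω : Ω) : ℝ := -log (P.real (Z ⁻¹' {Z ω}))

lemma integrable_surprisal [Finite α] [MeasurableSpace α] [MeasurableSingletonClass α]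
    (P : Measure Ω) [IsFiniteMeasure P] {Z : Ω → α} (hZ : Measurable Z) :
    Integrable (surprisal P Z) P :=
  integrable_comp_of_finite P hZ fun a => -log (P.real (Z ⁻¹' {a}))

variable [Fintype α] [Fintype β] [Fintype γ] [Fintype δ]

lemma entropy_nonneg (P : Measure Ω) [IsProbabilityMeasure P] (Z : Ω → α) : 0 ≤ entropy P Z :=
  Finset.sum_nonneg fun _ _ => Real.negMulLog_nonneg measureReal_nonneg measureReal_le_one

lemma entropy_of_subsingleton (P : Measure Ω) [IsProbabilityMeasure P] [Subsingleton α]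
    (Z : Ω → α) : entropy P Z = 0 := by
  refine Finset.sum_eq_zero fun a _ => ?_
  have hfiber : Z ⁻¹' {a} = Set.univ := Set.eq_univ_of_forall fun _ => Subsingleton.elim _ _
  rw [hfiber, probReal_univ, Real.negMulLog_one]

variable [MeasurableSpace α] [MeasurableSingletonClass α] [MeasurableSpace β]
  [MeasurableSingletonClass β] [MeasurableSpace γ] [MeasurableSingletonClass γ]
  [MeasurableSpace δ] [MeasurableSingletonClass δ] (P : Measure Ω) {Z : Ω → α} {W : Ω → β}

lemma integral_surprisal [IsFiniteMeasure P] (hZ : Measurable Z) :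
    ∫ ω, surprisal P Z ω ∂P = entropy P Z := by
  unfold surprisal entropy
  rw [integral_comp_eq_sum P hZ fun a => -log (P.real (Z ⁻¹' {a}))]
  exact Finset.sum_congr rfl fun a _ => by rw [negMulLog, mul_neg, neg_mul]

lemma entropy_le_of_factorsThrough [IsFiniteMeasure P] (hZ : Measurable Z) (hW : Measurable W)
    (h : W.FactorsThrough Z) : entropy P W ≤ entropy P Z := by
  rw [← integral_surprisal P hW, ← integral_surprisal P hZ]
  refine integral_mono_ae (integrable_surprisal P hW) (integrable_surprisal P hZ) ?_
  filter_upwards [ae_measureReal_fiber_pos P hZ] with ω hω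
  exact neg_le_neg (Real.log_le_log hω (measureReal_mono fun _ hω' => h hω'))

lemma entropy_congr [IsFiniteMeasure P] (hZ : Measurable Z) (hW : Measurable W)
    (h : ∀ ω ω', Z ω = Z ω' ↔ W ω = W ω') : entropy P Z = entropy P W :=
  le_antisymm (entropy_le_of_factorsThrough P hW hZ fun _ _ => (h _ _).2)
    (entropy_le_of_factorsThrough P hZ hW fun _ _ => (h _ _).1)

lemma mutualInfo_congr [IsFiniteMeasure P] {Z' : Ω → γ} {W' : Ω → δ} (hZ : Measurable Z)
    (hZ' : Measurable Z') (hW : Measurable W) (hW' : Measurable W')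
    (hZZ' : ∀ ω ω', Z ω = Z ω' ↔ Z' ω = Z' ω') (hWW' : ∀ ω ω', W ω = W ω' ↔ W' ω = W' ω') :
    mutualInfo P Z W = mutualInfo P Z' W' := by
  rw [mutualInfo, mutualInfo, entropy_congr P hZ hZ' hZZ', entropy_congr P hW hW' hWW',
    entropy_congr P (hZ.prodMk hW) (hZ'.prodMk hW') fun ω ω' => by
      simp only [Prod.mk.injEq, hZZ' ω ω', hWW' ω ω']]

lemma entropy_comp_measurePreserving {P : Measure Ω} {T : Ω → Ω} (hT : MeasurePreserving T P P)
    (hZ : Measurable Z) : entropy P (Z ∘ T) = entropy P Z := by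
  refine Finset.sum_congr rfl fun a _ => ?_
  rw [Set.preimage_comp,
    hT.measureReal_preimage (hZ (measurableSet_singleton a)).nullMeasurableSet]

lemma negMulLog_le_mul_neg_log_add_sub {p q : ℝ} (hp : 0 ≤ p) (hq : 0 ≤ q) (hpq : 0 < p → 0 < q) :
    negMulLog p ≤ p * -log q + (q - p) := by
  obtain rfl | hp := hp.eq_or_lt
  · simpa using hq
  · have hlog := Real.log_le_sub_one_of_pos (div_pos (hpq hp) hp)
    rw [Real.log_div (hpq hp).ne' hp.ne', ← mul_le_mul_iff_right₀ hp, mul_sub, mul_sub,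
      mul_div_cancel₀ q hp.ne'] at hlog
    rw [negMulLog]
    linarith

lemma entropy_le_integral_neg_log [IsProbabilityMeasure P] (hZ : Measurable Z) {q : α → ℝ}
    (hq : ∀ a, 0 ≤ q a) (hpq : ∀ a, 0 < P.real (Z ⁻¹' {a}) → 0 < q a) (hsum : ∑ a, q a ≤ 1) :
    entropy P Z ≤ ∫ ω, -log (q (Z ω)) ∂P := by
  rw [integral_comp_eq_sum P hZ fun a => -log (q a)]
  calc entropy P Z
      ≤ ∑ a, (P.real (Z ⁻¹' {a}) * -log (q a) + (q a - P.real (Z ⁻¹' {a}))) :=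
        Finset.sum_le_sum fun a _ =>
          negMulLog_le_mul_neg_log_add_sub measureReal_nonneg (hq a) (hpq a)
    _ ≤ ∑ a, P.real (Z ⁻¹' {a}) * -log (q a) := by
        rw [Finset.sum_add_distrib, Finset.sum_sub_distrib, sum_measureReal_fiber P hZ,
          probReal_univ]
        linarith

lemma entropy_le_log_card [IsProbabilityMeasure P] (hZ : Measurable Z) :
    entropy P Z ≤ log (Fintype.card α) := by
  have : Nonempty α := (nonempty_of_isProbabilityMeasure P).map Z
  calc entropy P Z ≤ ∫ _, -log (Fintype.card α : ℝ)⁻¹ ∂P :=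
        entropy_le_integral_neg_log P hZ (q := fun _ => (Fintype.card α : ℝ)⁻¹)
          (fun _ => by positivity) (fun _ _ => by positivity) (by simp)
    _ = log (Fintype.card α) := by simp

lemma sum_prodMk_fiber_mul_div_eq_one [IsProbabilityMeasure P] {A : Ω → α} {B : Ω → β}
    {C : Ω → γ} (hA : Measurable A) (hB : Measurable B) (hC : Measurable C) :
    ∑ x : γ × α × β, P.real ((fun ω => (C ω, A ω)) ⁻¹' {(x.1, x.2.1)}) *
      P.real ((fun ω => (C ω, B ω)) ⁻¹' {(x.1, x.2.2)}) / P.real (C ⁻¹' {x.1}) = 1 := by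
  simp_rw [Fintype.sum_prod_type, ← Finset.sum_div, ← Finset.mul_sum, ← Finset.sum_mul,
    sum_measureReal_prodMk_fiber P hA, sum_measureReal_prodMk_fiber P hB, mul_self_div_self]
  rw [sum_measureReal_fiber P hC, probReal_univ]

lemma entropy_submodular [IsProbabilityMeasure P] {A : Ω → α} {B : Ω → β} {C : Ω → γ}
    (hA : Measurable A) (hB : Measurable B) (hC : Measurable C) :
    entropy P (fun ω => (C ω, A ω, B ω)) + entropy P C ≤
      entropy P (fun ω => (C ω, A ω)) + entropy P (fun ω => (C ω, B ω)) := by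
  have hCA := hC.prodMk hA
  have hCB := hC.prodMk hB
  -- Gibbs' inequality against the law that makes `A` and `B` independent given `C`.
  let q : γ × α × β → ℝ := fun x => P.real ((fun ω => (C ω, A ω)) ⁻¹' {(x.1, x.2.1)}) *
    P.real ((fun ω => (C ω, B ω)) ⁻¹' {(x.1, x.2.2)}) / P.real (C ⁻¹' {x.1})
  have hgibbs : entropy P (fun ω => (C ω, A ω, B ω)) ≤ ∫ ω, -log (q (C ω, A ω, B ω)) ∂P := by
    refine entropy_le_integral_neg_log P (hC.prodMk (hA.prodMk hB)) (q := q)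
      (fun _ => by positivity) (fun x hx => ?_) (sum_prodMk_fiber_mul_div_eq_one P hA hB hC).le
    refine div_pos (mul_pos ?_ ?_) ?_ <;>
      exact hx.trans_le (measureReal_mono fun ω hω => by
        simp only [Set.mem_preimage, Set.mem_singleton_iff, Prod.ext_iff] at hω ⊢
        tauto)
  have hlog : ∫ ω, -log (q (C ω, A ω, B ω)) ∂P =
      entropy P (fun ω => (C ω, A ω)) + entropy P (fun ω => (C ω, B ω)) - entropy P C := by
    rw [← integral_surprisal P hCA, ← integral_surprisal P hCB, ← integral_surprisal P hC,
      ← integral_add' (integrable_surprisal P hCA) (integrable_surprisal P hCB),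
      ← integral_sub' ((integrable_surprisal P hCA).add (integrable_surprisal P hCB))
        (integrable_surprisal P hC)]
    refine integral_congr_ae ?_
    filter_upwards [ae_measureReal_fiber_pos P hCA, ae_measureReal_fiber_pos P hCB,
      ae_measureReal_fiber_pos P hC] with ω hωCA hωCB hωC
    simp only [q, surprisal, Pi.sub_apply, Pi.add_apply]
    rw [Real.log_div (mul_pos hωCA hωCB).ne' hωC.ne', Real.log_mul hωCA.ne' hωCB.ne']
    ring
  linarith

end Entropy

section Marginal

variable {ι α : Type*}

lemma measurableSet_letter_eq [MeasurableSpace α] [MeasurableSingletonClass α] (i : ι) (a : α) :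
    MeasurableSet {x : ι → α | x i = a} :=
  measurable_pi_apply (X := fun _ => α) i (measurableSet_singleton a)

lemma restrict_eq_restrict_iff {A : Finset ι} {x y : ι → α} :
    A.restrict x = A.restrict y ↔ ∀ i ∈ A, x i = y i := by
  simp only [funext_iff, Finset.restrict, Subtype.forall]

variable [DecidableEq ι] [Fintype α] [MeasurableSpace α]

/-- The entropy of the letters at the positions in `A` of a process with law `μ`. -/
noncomputable def marginalEntropy (μ : Measure (ι → α)) (A : Finset ι) : ℝ :=
  entropy μ (A.restrict : (ι → α) → A → α)

variable (μ : Measure (ι → α)) [IsProbabilityMeasure μ]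

lemma marginalEntropy_nonneg (A : Finset ι) : 0 ≤ marginalEntropy μ A := entropy_nonneg μ _

lemma marginalEntropy_empty : marginalEntropy μ ∅ = 0 := entropy_of_subsingleton μ _

variable [MeasurableSingletonClass α]

lemma marginalEntropy_le_card_mul_log_card (A : Finset ι) :
    marginalEntropy μ A ≤ A.card * log (Fintype.card α) :=
  (entropy_le_log_card μ (Finset.measurable_restrict A)).trans_eq (by simp)

lemma marginalEntropy_mono : Monotone (marginalEntropy μ) := fun A B hAB =>
  entropy_le_of_factorsThrough μ (Finset.measurable_restrict B) (Finset.measurable_restrict A)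
    fun _ _ h => restrict_eq_restrict_iff.2 fun i hi => restrict_eq_restrict_iff.1 h i (hAB hi)

lemma marginalEntropy_union_add_inter_le (A B : Finset ι) :
    marginalEntropy μ (A ∪ B) + marginalEntropy μ (A ∩ B) ≤
      marginalEntropy μ A + marginalEntropy μ B := by
  have hmeas (C : Finset ι) := Finset.measurable_restrict C (X := fun _ => α)
  have hsub := entropy_submodular μ (hmeas A) (hmeas B) (hmeas (A ∩ B))
  have hunion : entropy μ (fun x => ((A ∩ B).restrict x, A.restrict x, B.restrict x)) =
      marginalEntropy μ (A ∪ B) := by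
    refine entropy_congr μ ((hmeas _).prodMk ((hmeas _).prodMk (hmeas _))) (hmeas _) fun x y => ?_
    simp only [Prod.mk.injEq, restrict_eq_restrict_iff, Finset.mem_inter, Finset.mem_union]
    grind
  have hleft : entropy μ (fun x => ((A ∩ B).restrict x, A.restrict x)) = marginalEntropy μ A := by
    refine entropy_congr μ ((hmeas _).prodMk (hmeas _)) (hmeas _) fun x y => ?_
    simp only [Prod.mk.injEq, restrict_eq_restrict_iff, Finset.mem_inter]
    grind
  have hright : entropy μ (fun x => ((A ∩ B).restrict x, B.restrict x)) = marginalEntropy μ B := by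
    refine entropy_congr μ ((hmeas _).prodMk (hmeas _)) (hmeas _) fun x y => ?_
    simp only [Prod.mk.injEq, restrict_eq_restrict_iff, Finset.mem_inter]
    grind
  rwa [hunion, hleft, hright] at hsub

lemma marginalEntropy_union_le (A B : Finset ι) :
    marginalEntropy μ (A ∪ B) ≤ marginalEntropy μ A + marginalEntropy μ B :=
  (le_add_of_nonneg_right (marginalEntropy_nonneg μ _)).trans
    (marginalEntropy_union_add_inter_le μ A B)

lemma marginalEntropy_insert_sub_le {R A : Finset ι} (hRA : R ⊆ A) {a : ι} (ha : a ∉ A) :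
    marginalEntropy μ (insert a A) - marginalEntropy μ A ≤
      marginalEntropy μ (insert a R) - marginalEntropy μ R := by
  have hsub := marginalEntropy_union_add_inter_le μ (insert a R) A
  rw [Finset.insert_union, Finset.union_eq_right.2 hRA, Finset.insert_inter_of_notMem ha,
    Finset.inter_eq_left.2 hRA] at hsub
  linarith

end Marginal

section Erasures

variable {ι α : Type*}

/-- The positions in `A` that the erasure pattern `e` leaves intact. -/
def unerased (A : Finset ι) (e : ι → Fin 2) : Finset ι := A.filter fun i => e i = 1

lemma dependsOn_unerased (A : Finset ι) : DependsOn (unerased A) A := fun _ _ h =>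
  Finset.filter_congr fun i hi => by rw [h i hi]

lemma integrable_comp_unerased (ν : Measure (ι → Fin 2)) [IsFiniteMeasure ν] (A : Finset ι)
    (G : Finset ι → ℝ) : Integrable (fun e => G (unerased A e)) ν := by
  obtain ⟨g, hg⟩ := dependsOn_iff_exists_comp.1 (dependsOn_unerased A)
  simp_rw [hg]
  exact integrable_comp_of_finite ν (Finset.measurable_restrict A) (G ∘ g)

lemma integral_card_unerased (ν : Measure (ι → Fin 2)) [IsFiniteMeasure ν] (A : Finset ι) :
    ∫ e, ((unerased A e).card : ℝ) ∂ν = ∑ i ∈ A, ν.real {e | e i = 1} := by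
  have hcard (e : ι → Fin 2) :
      ((unerased A e).card : ℝ) = ∑ i ∈ A, {e : ι → Fin 2 | e i = 1}.indicator (fun _ => 1) e := by
    simp [unerased, Set.indicator_apply]
  simp_rw [hcard]
  rw [integral_finsetSum _ fun i _ =>
    (integrable_const (1 : ℝ)).indicator (measurableSet_letter_eq i 1)]
  simp_rw [integral_indicator_const _ (measurableSet_letter_eq _ _), smul_eq_mul, mul_one]

variable [DecidableEq ι] [Fintype α] [MeasurableSpace α]

/-- The entropy, averaged over the erasures, of the letters in `A` that are not erased. For the
erasure channel it is the mutual information of input and output on `A`. -/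
noncomputable def meanUnerasedEntropy (μ : Measure (ι → α)) (ν : Measure (ι → Fin 2))
    (A : Finset ι) : ℝ :=
  ∫ e, marginalEntropy μ (unerased A e) ∂ν

variable (μ : Measure (ι → α)) [IsProbabilityMeasure μ] (ν : Measure (ι → Fin 2))

lemma meanUnerasedEntropy_nonneg (A : Finset ι) : 0 ≤ meanUnerasedEntropy μ ν A :=
  integral_nonneg fun _ => marginalEntropy_nonneg μ _

variable [MeasurableSingletonClass α]

lemma meanUnerasedEntropy_union_le [IsFiniteMeasure ν] (A B : Finset ι) :
    meanUnerasedEntropy μ ν (A ∪ B) ≤ meanUnerasedEntropy μ ν A + meanUnerasedEntropy μ ν B := by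
  have hint (C : Finset ι) := integrable_comp_unerased ν C (marginalEntropy μ)
  unfold meanUnerasedEntropy
  rw [← integral_add (hint A) (hint B)]
  refine integral_mono (hint _) ((hint A).add (hint B)) fun e => ?_
  simp only [unerased, Finset.filter_union]
  exact marginalEntropy_union_le μ _ _

lemma meanUnerasedEntropy_le_marginalEntropy [IsProbabilityMeasure ν] (A : Finset ι) :
    meanUnerasedEntropy μ ν A ≤ marginalEntropy μ A :=
  (integral_mono (integrable_comp_unerased ν A _) (integrable_const _) fun _ =>
    marginalEntropy_mono μ (Finset.filter_subset _ _)).trans_eq (by simp)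

lemma meanUnerasedEntropy_le_sum_mul_log_card [IsFiniteMeasure ν] (A : Finset ι) :
    meanUnerasedEntropy μ ν A ≤ (∑ i ∈ A, ν.real {e | e i = 1}) * log (Fintype.card α) := by
  rw [← integral_card_unerased, ← integral_mul_const]
  exact integral_mono (integrable_comp_unerased ν A _)
    (integrable_comp_unerased ν A fun B => (B.card : ℝ) * log (Fintype.card α))
    fun _ => marginalEntropy_le_card_mul_log_card μ _

lemma meanUnerasedEntropy_add_mul_le_insert [IsFiniteMeasure ν] {A : Finset ι} {a : ι}
    (ha : a ∉ A) :
    meanUnerasedEntropy μ ν A +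
        ν.real {e | e a = 1} * (marginalEntropy μ (insert a A) - marginalEntropy μ A) ≤
      meanUnerasedEntropy μ ν (insert a A) := by
  have hmeas := measurableSet_letter_eq (α := Fin 2) a 1
  have hint (C : Finset ι) := integrable_comp_unerased ν C (marginalEntropy μ)
  rw [← smul_eq_mul, ← integral_indicator_const _ hmeas]
  have hincr := (integrable_const (μ := ν)
    (marginalEntropy μ (insert a A) - marginalEntropy μ A)).indicator hmeas
  unfold meanUnerasedEntropy
  rw [← integral_add (hint A) hincr]
  refine integral_mono ((hint A).add hincr) (hint _) fun e => ?_
  have hdim := marginalEntropy_insert_sub_le μ (Finset.filter_subset (fun i => e i = 1) A) ha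
  by_cases hea : e a = 1
  · simp only [unerased, Finset.filter_insert, Set.indicator_apply, Set.mem_ofPred_eq, hea, if_true]
    linarith
  · simp [unerased, Finset.filter_insert, hea]

lemma mul_marginalEntropy_le_meanUnerasedEntropy [IsFiniteMeasure ν] {q : ℝ}
    (hq : ∀ i, ν.real {e | e i = 1} = q) (A : Finset ι) :
    q * marginalEntropy μ A ≤ meanUnerasedEntropy μ ν A := by
  induction A using Finset.induction_on with
  | empty =>
    rw [marginalEntropy_empty, mul_zero]
    exact meanUnerasedEntropy_nonneg μ ν ∅
  | insert a A ha ih =>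
    have hstep := meanUnerasedEntropy_add_mul_le_insert μ ν ha
    rw [hq] at hstep
    linarith

end Erasures

section Product

variable {Ω₁ Ω₂ α β : Type*} [MeasurableSpace Ω₁] [MeasurableSpace Ω₂] [Fintype α] [Fintype β]
  (μ : Measure Ω₁) (ν : Measure Ω₂) [IsProbabilityMeasure ν]

lemma entropy_prod_fst (Z : Ω₁ → α) : entropy (μ.prod ν) (fun ω => Z ω.1) = entropy μ Z := by
  refine Finset.sum_congr rfl fun a _ => ?_
  have hfiber : (fun ω : Ω₁ × Ω₂ => Z ω.1) ⁻¹' {a} = (Z ⁻¹' {a}) ×ˢ Set.univ := by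
    ext
    simp
  rw [hfiber, measureReal_prod_prod, probReal_univ, mul_one]

lemma entropy_prodMk_eq_add_integral [IsProbabilityMeasure μ] [MeasurableSpace α]
    [MeasurableSingletonClass α] [MeasurableSpace β] [MeasurableSingletonClass β] {f : Ω₁ → β → α}
    (hf : ∀ b, Measurable fun x => f x b) {Z : Ω₂ → β} (hZ : Measurable Z) :
    entropy (μ.prod ν) (fun ω => (f ω.1 (Z ω.2), Z ω.2)) =
      entropy ν Z + ∫ y, entropy μ (fun x => f x (Z y)) ∂ν := by
  have hfiber (a : α) (b : β) : (fun ω : Ω₁ × Ω₂ => (f ω.1 (Z ω.2), Z ω.2)) ⁻¹' {(a, b)} =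
      ((fun x => f x b) ⁻¹' {a}) ×ˢ (Z ⁻¹' {b}) := by
    ext ω
    simp only [Set.mem_preimage, Set.mem_singleton_iff, Prod.mk.injEq, Set.mem_prod]
    grind
  rw [integral_comp_eq_sum ν hZ fun b => entropy μ fun x => f x b]
  unfold entropy
  rw [Fintype.sum_prod_type, Finset.sum_comm, ← Finset.sum_add_distrib]
  refine Finset.sum_congr rfl fun b _ => ?_
  simp_rw [hfiber, measureReal_prod_prod, Real.negMulLog_mul]
  rw [Finset.sum_add_distrib, ← Finset.mul_sum, ← Finset.sum_mul, sum_measureReal_fiber μ (hf b),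
    probReal_univ]
  ring

end Product

section Channel

variable {K : ℕ}

lemma erase_eq_erase_iff {x y : Input K} {d e : Fin 2} :
    erase x d = erase y e ↔ d = e ∧ (e = 1 → x = y) := by
  have hx := (Finset.mem_Icc.1 x.2).1
  have hy := (Finset.mem_Icc.1 y.2).1
  rw [erase, erase, Fin.mk.injEq, ← Subtype.coe_inj]
  fin_cases d <;> fin_cases e <;> simp <;> omega

lemma measurable_erase {Ω : Type*} [MeasurableSpace Ω] {X : Ω → Input K} {E : Ω → Fin 2}
    (hX : Measurable X) (hE : Measurable E) : Measurable fun ω => erase (X ω) (E ω) :=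
  (measurable_of_finite fun a : Input K × Fin 2 => erase a.1 a.2).comp (hX.prodMk hE)

variable {ι : Type*}

lemma measurable_erase_restrict (A : Finset ι) :
    Measurable fun (ω : (ι → Input K) × (ι → Fin 2)) (i : A) => erase (ω.1 i) (ω.2 i) :=
  measurable_pi_lambda _ fun _ => measurable_erase ((measurable_pi_apply _).comp measurable_fst)
    ((measurable_pi_apply _).comp measurable_snd)

variable [DecidableEq ι]

lemma marginalEntropy_unerased (μ : Measure (ι → Input K)) [IsProbabilityMeasure μ]
    (A : Finset ι) (e : ι → Fin 2) :
    marginalEntropy μ (unerased A e) = entropy μ fun x (i : A) => erase (x i) (e i) := by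
  refine entropy_congr μ (Finset.measurable_restrict _)
    ((measurable_erase_restrict A).comp measurable_prodMk_right) fun x y => ?_
  rw [restrict_eq_restrict_iff]
  simp only [unerased, Finset.mem_filter, funext_iff, Subtype.forall, erase_eq_erase_iff, true_and,
    and_imp]

/-- Both `H(Y)` and `H(X, Y)` are computed by adjoining the erasures, which `Y` determines because
no input letter is `0`. -/
lemma mutualInfo_erase (μ : Measure (ι → Input K)) [IsProbabilityMeasure μ]
    (ν : Measure (ι → Fin 2)) [IsProbabilityMeasure ν] (A : Finset ι) :
    mutualInfo (μ.prod ν) (fun ω => A.restrict ω.1)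
      (fun ω (i : A) => erase (ω.1 i) (ω.2 i)) = meanUnerasedEntropy μ ν A := by
  have hX : Measurable fun ω : (ι → Input K) × (ι → Fin 2) => A.restrict ω.1 :=
    (Finset.measurable_restrict A).comp measurable_fst
  have hE : Measurable fun ω : (ι → Input K) × (ι → Fin 2) => A.restrict ω.2 :=
    (Finset.measurable_restrict A).comp measurable_snd
  have hY := measurable_erase_restrict (K := K) A
  have houtput : entropy (μ.prod ν) (fun ω (i : A) => erase (ω.1 i) (ω.2 i)) =
      entropy ν A.restrict + meanUnerasedEntropy μ ν A := by
    have hchain := entropy_prodMk_eq_add_integral μ ν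
      (f := fun (x : ι → Input K) (b : A → Fin 2) (i : A) => erase (x i) (b i))
      (fun b => measurable_pi_lambda _ fun _ => measurable_erase (measurable_pi_apply _)
        measurable_const) (Finset.measurable_restrict A)
    simp_rw [meanUnerasedEntropy, marginalEntropy_unerased]
    refine Eq.trans (entropy_congr _ hY (hY.prodMk hE) fun ω ω' => ?_) hchain
    simp only [Prod.mk.injEq, funext_iff, Finset.restrict, erase_eq_erase_iff, forall_and]
    tauto
  have hjoint : entropy (μ.prod ν)
      (fun ω => (A.restrict ω.1, fun i : A => erase (ω.1 i) (ω.2 i))) =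
      entropy ν A.restrict + entropy μ A.restrict := by
    have hchain := entropy_prodMk_eq_add_integral μ ν (f := fun x (_ : A → Fin 2) => A.restrict x)
      (fun _ => Finset.measurable_restrict A) (Finset.measurable_restrict A)
    rw [integral_const, probReal_univ, one_smul] at hchain
    refine Eq.trans (entropy_congr _ (hX.prodMk hY) (hX.prodMk hE) fun ω ω' => ?_) hchain
    simp only [Prod.mk.injEq, funext_iff, Finset.restrict, erase_eq_erase_iff, forall_and]
    exact ⟨fun h => ⟨h.1, h.2.1⟩, fun h => ⟨h.1, h.2, fun i _ => h.1 i⟩⟩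
  rw [mutualInfo, entropy_prod_fst, houtput, hjoint]
  ring

lemma forall_fin_add_one_iff_forall_mem_Icc {n : ℕ} {p : ℤ → Prop} :
    (∀ k : Fin n, p (k + 1)) ↔ ∀ i ∈ Finset.Icc 1 (n : ℤ), p i := by
  refine ⟨fun h i hi => ?_, fun h k => h _ (Finset.mem_Icc.2 (by omega))⟩
  obtain ⟨hi₁, hin⟩ := Finset.mem_Icc.1 hi
  have hk := h ⟨(i - 1).toNat, by omega⟩
  rwa [Int.toNat_of_nonneg (by omega), sub_add_cancel] at hk

lemma blockRate_eq (μ : Measure (ℤ → Input K)) [IsProbabilityMeasure μ]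
    (ν : Measure (ℤ → Fin 2)) [IsProbabilityMeasure ν] (n : ℕ) :
    blockRate μ ν n = meanUnerasedEntropy μ ν (Finset.Icc 1 (n : ℤ)) / n := by
  rw [blockRate, ← mutualInfo_erase]
  congr 1
  refine mutualInfo_congr _
    (measurable_pi_lambda _ fun k => (measurable_pi_apply _).comp measurable_fst)
    ((Finset.measurable_restrict _).comp measurable_fst)
    (measurable_pi_lambda _ fun _ => measurable_erase ((measurable_pi_apply _).comp measurable_fst)
      ((measurable_pi_apply _).comp measurable_snd))
    (measurable_erase_restrict _) (fun ω ω' => ?_) fun ω ω' => ?_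
  · rw [restrict_eq_restrict_iff, funext_iff]
    exact forall_fin_add_one_iff_forall_mem_Icc (p := fun i => ω.1 i = ω'.1 i)
  · rw [funext_iff, funext_iff, Subtype.forall]
    exact forall_fin_add_one_iff_forall_mem_Icc
      (p := fun i => erase (ω.1 i) (ω.2 i) = erase (ω'.1 i) (ω'.2 i))

end Channel

section Stationary

lemma shift_iterate {α : Type*} (m : ℕ) (x : ℤ → α) (i : ℤ) : shift^[m] x i = x (i + m) := by
  induction m generalizing x with
  | zero => simp
  | succ m ih =>
    rw [Function.iterate_succ_apply, ih, shift]
    congr 1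
    push_cast
    ring

lemma measureReal_letter_eq {α : Type*} [MeasurableSpace α] [MeasurableSingletonClass α]
    {ν : Measure (ℤ → α)} (hν : MeasurePreserving shift ν ν) (a : α) (i j : ℤ) :
    ν.real {e | e i = a} = ν.real {e | e j = a} := by
  have hper : Function.Periodic (fun k : ℤ => ν.real {e | e k = a}) 1 := fun k =>
    hν.measureReal_preimage (measurableSet_letter_eq k a).nullMeasurableSet
  simpa using (hper.int_mul_eq i).trans (hper.int_mul_eq j).symm

lemma measureReal_letter_eq_one {ι : Type*} (ν : Measure (ι → Fin 2))
    [IsProbabilityMeasure ν] (i : ι) : ν.real {e | e i = 1} = 1 - ν.real {e | e i = 0} := by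
  have hsum := sum_measureReal_fiber ν (measurable_pi_apply (X := fun _ => Fin 2) i)
  rw [Fin.sum_univ_two, probReal_univ] at hsum
  exact eq_sub_of_add_eq' hsum

lemma unerased_map_addRight (A : Finset ℤ) (m : ℕ) (e : ℤ → Fin 2) :
    unerased (A.map (addRightEmbedding (m : ℤ))) e =
      (unerased A (shift^[m] e)).map (addRightEmbedding (m : ℤ)) := by
  rw [unerased, Finset.filter_map]
  congr 2
  ext i
  simp [shift_iterate]

variable {α : Type*} [Fintype α] [MeasurableSpace α] [MeasurableSingletonClass α]
  {μ : Measure (ℤ → α)} [IsProbabilityMeasure μ]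

lemma marginalEntropy_map_addRight (hμ : MeasurePreserving shift μ μ) (A : Finset ℤ) (m : ℕ) :
    marginalEntropy μ (A.map (addRightEmbedding (m : ℤ))) = marginalEntropy μ A := by
  refine Eq.trans ?_ (entropy_comp_measurePreserving (hμ.iterate m) (Finset.measurable_restrict A))
  refine entropy_congr μ (Finset.measurable_restrict _)
    ((Finset.measurable_restrict A).comp (hμ.iterate m).measurable) fun x y => ?_
  rw [Function.comp_apply, Function.comp_apply, restrict_eq_restrict_iff, restrict_eq_restrict_iff]
  simp [shift_iterate]

variable {ν : Measure (ℤ → Fin 2)}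

lemma meanUnerasedEntropy_map_addRight [IsFiniteMeasure ν] (hμ : MeasurePreserving shift μ μ)
    (hν : MeasurePreserving shift ν ν) (A : Finset ℤ) (m : ℕ) :
    meanUnerasedEntropy μ ν (A.map (addRightEmbedding (m : ℤ))) = meanUnerasedEntropy μ ν A := by
  simp_rw [meanUnerasedEntropy, unerased_map_addRight, marginalEntropy_map_addRight hμ]
  have hm := hν.iterate m
  rw [← integral_map hm.measurable.aemeasurable (f := fun e => marginalEntropy μ (unerased A e)),
    hm.map_eq]
  rw [hm.map_eq]
  exact (integrable_comp_unerased ν A _).aestronglyMeasurable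

lemma subadditive_meanUnerasedEntropy_Icc [IsFiniteMeasure ν] (hμ : MeasurePreserving shift μ μ)
    (hν : MeasurePreserving shift ν ν) :
    Subadditive fun n : ℕ => meanUnerasedEntropy μ ν (Finset.Icc 1 (n : ℤ)) := fun m n => by
  have hsplit : Finset.Icc 1 ((m + n : ℕ) : ℤ) =
      Finset.Icc 1 (m : ℤ) ∪ (Finset.Icc 1 (n : ℤ)).map (addRightEmbedding (m : ℤ)) := by
    ext i
    rw [Finset.map_add_right_Icc, Finset.mem_union, Finset.mem_Icc, Finset.mem_Icc, Finset.mem_Icc]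
    omega
  beta_reduce
  rw [hsplit, ← meanUnerasedEntropy_map_addRight hμ hν (Finset.Icc 1 (n : ℤ)) m]
  exact meanUnerasedEntropy_union_le μ ν _ _

end Stationary

section Rate

variable {K : ℕ} {μ : Measure (ℤ → Input K)} {ν ν' : Measure (ℤ → Fin 2)}
  [IsProbabilityMeasure μ] [IsProbabilityMeasure ν] [IsProbabilityMeasure ν']

lemma tendsto_blockRate (hμ : MeasurePreserving shift μ μ) (hν : MeasurePreserving shift ν ν) :
    Tendsto (blockRate μ ν) atTop (𝓝 (mutualInfoRate μ ν)) := by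
  have hlim := (subadditive_meanUnerasedEntropy_Icc hμ hν).tendsto_lim
    ⟨0, Set.forall_mem_range.2 fun n => div_nonneg (meanUnerasedEntropy_nonneg μ ν _) n.cast_nonneg⟩
  rw [← funext (blockRate_eq μ ν)] at hlim
  exact tendsto_nhds_limUnder ⟨_, hlim⟩

lemma mutualInfoRate_le (hμ : MeasurePreserving shift μ μ) (hν : MeasurePreserving shift ν ν) :
    mutualInfoRate μ ν ≤ ν.real {e | e 1 = 1} * log K := by
  refine le_of_tendsto (tendsto_blockRate hμ hν) ?_
  filter_upwards [eventually_gt_atTop 0] with n hn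
  rw [blockRate_eq, div_le_iff₀ (by exact_mod_cast hn)]
  have hsum : ∑ i ∈ Finset.Icc 1 (n : ℤ), ν.real {e | e i = 1} = n * ν.real {e | e 1 = 1} := by
    rw [Finset.sum_congr rfl fun i _ => measureReal_letter_eq hν 1 i 1]
    simp
  refine (meanUnerasedEntropy_le_sum_mul_log_card μ ν _).trans_eq ?_
  rw [hsum, Fintype.card_coe, Nat.card_Icc, add_tsub_cancel_right]
  ring

lemma mul_mutualInfoRate_le (hμ : MeasurePreserving shift μ μ) (hν : MeasurePreserving shift ν ν)
    (hν' : MeasurePreserving shift ν' ν') :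
    ν.real {e | e 1 = 1} * mutualInfoRate μ ν' ≤ mutualInfoRate μ ν := by
  refine le_of_tendsto_of_tendsto' ((tendsto_blockRate hμ hν').const_mul _)
    (tendsto_blockRate hμ hν) fun n => ?_
  rw [blockRate_eq, blockRate_eq, ← mul_div_assoc]
  gcongr
  calc ν.real {e | e 1 = 1} * meanUnerasedEntropy μ ν' (Finset.Icc 1 (n : ℤ))
      ≤ ν.real {e | e 1 = 1} * marginalEntropy μ (Finset.Icc 1 (n : ℤ)) := by
        gcongr
        exact meanUnerasedEntropy_le_marginalEntropy μ ν' _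
    _ ≤ meanUnerasedEntropy μ ν (Finset.Icc 1 (n : ℤ)) :=
        mul_marginalEntropy_le_meanUnerasedEntropy μ ν (fun i => measureReal_letter_eq hν 1 i 1) _

end Rate

section Capacity

variable {K : ℕ} {S : Set (List (Input K))} {ν ν' : Measure (ℤ → Fin 2)}
  [IsProbabilityMeasure ν] [IsProbabilityMeasure ν']

lemma le_of_mem_achievableRates (hν : MeasurePreserving shift ν ν) {r : ℝ}
    (hr : r ∈ achievableRates S ν) : r ≤ ν.real {e | e 1 = 1} * log K := by
  obtain ⟨μ, hμ, rfl⟩ := hr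
  have := hμ.prob
  exact mutualInfoRate_le hμ.stationary hν

lemma capacityWellDefined (hadm : ∃ μ, IsAdmissibleInput S μ) (hν : MeasurePreserving shift ν ν) :
    CapacityWellDefined S ν where
  tendsto _ hμ :=
    have := hμ.prob
    tendsto_blockRate hμ.stationary hν
  nonempty := hadm.imp' (fun μ => mutualInfoRate μ ν) fun μ hμ => ⟨μ, hμ, rfl⟩
  bddAbove := ⟨_, fun _ => le_of_mem_achievableRates hν⟩

lemma capacity_le (hadm : ∃ μ, IsAdmissibleInput S μ) (hν : MeasurePreserving shift ν ν) :
    capacity S ν ≤ ν.real {e | e 1 = 1} * log K :=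
  csSup_le (capacityWellDefined hadm hν).nonempty fun _ => le_of_mem_achievableRates hν

lemma mul_capacity_le (hadm : ∃ μ, IsAdmissibleInput S μ) (hν : MeasurePreserving shift ν ν)
    (hν' : MeasurePreserving shift ν' ν') :
    ν.real {e | e 1 = 1} * capacity S ν' ≤ capacity S ν := by
  rw [capacity, ← smul_eq_mul, ← Real.sSup_smul_of_nonneg measureReal_nonneg]
  refine csSup_le (capacityWellDefined hadm hν').nonempty.smul_set ?_
  rintro _ ⟨_, ⟨μ, hμ, rfl⟩, rfl⟩
  have := hμ.prob
  exact (mul_mutualInfoRate_le hμ.stationary hν hν').trans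
    (le_csSup (capacityWellDefined hadm hν).bddAbove ⟨μ, hμ, rfl⟩)

end Capacity

section Words

variable {α : Type*} {x : ℤ → α}

lemma readsAt_append {i : ℤ} {s t : List α} :
    ReadsAt x i (s ++ t) ↔ ReadsAt x i s ∧ ReadsAt x (i + s.length) t := by
  simp only [ReadsAt, List.get_eq_getElem, Fin.forall_iff, List.length_append]
  refine ⟨fun h => ⟨fun k hk => ?_, fun k hk => ?_⟩, fun h k hk => ?_⟩
  · rw [h k (by omega), List.getElem_append_left hk]
  · have hread := h (s.length + k) (by omega)
    rw [List.getElem_append_right (by omega)] at hread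
    simpa [add_assoc] using hread
  · rcases lt_or_ge k s.length with hks | hks
    · rw [h.1 k hks, List.getElem_append_left hks]
    · have hread := h.2 (k - s.length) (by omega)
      rw [List.getElem_append_right hks, ← hread]
      congr 1
      omega

lemma ReadsAt.exists_of_isInfix {i : ℤ} {f w : List α} (hw : ReadsAt x i w) (hf : f <:+: w) :
    ∃ j, ReadsAt x j f := by
  obtain ⟨s, t, rfl⟩ := hf
  exact ⟨_, (readsAt_append.1 (readsAt_append.1 hw).1).2⟩

lemma ReadsAt.eq_of_length_eq {i : ℤ} {v w : List α} (hv : ReadsAt x i v) (hw : ReadsAt x i w)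
    (hlen : v.length = w.length) : v = w :=
  List.ext_get hlen fun k hkv hkw => (hv ⟨k, hkv⟩).symm.trans (hw ⟨k, hkw⟩)

lemma ReadsAt.isInfix {i : ℤ} {j : ℕ} {f v : List α} (hv : ReadsAt x i v)
    (hf : ReadsAt x (i + j) f) (hlen : j + f.length ≤ v.length) : f <:+: v := by
  have hread := hv
  rw [← List.take_append_drop j v, readsAt_append, ← List.take_append_drop f.length (v.drop j),
    readsAt_append, List.length_take_of_le (by omega)] at hread
  have hmiddle : (v.drop j).take f.length = f :=
    hread.2.1.eq_of_length_eq hf (by rw [List.length_take_of_le (by rw [List.length_drop]; omega)])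
  rw [← hmiddle]
  exact (List.take_prefix _ _).isInfix.trans (List.drop_suffix _ _).isInfix

lemma readsAt_shift_iterate {k : ℕ} {i : ℤ} {w : List α} :
    ReadsAt (shift^[k] x) i w ↔ ReadsAt x (i + k) w := by
  simp only [ReadsAt, shift_iterate, add_right_comm]

lemma periodic_readsAt {p : ℤ} (hx : Function.Periodic x p) (w : List α) :
    Function.Periodic (fun i => ReadsAt x i w) p := fun i => by
  simp only [ReadsAt, add_right_comm i p, hx _]

lemma exists_periodic_readsAt {c : List α} (hc : c ≠ []) :
    ∃ x : ℤ → α, Function.Periodic x c.length ∧ ReadsAt x 0 c := by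
  have hpos := List.length_pos_iff.2 hc
  have hlt (i : ℤ) : (i % c.length).toNat < c.length := by
    have := Int.emod_lt_of_pos i (Int.natCast_pos.2 hpos)
    omega
  refine ⟨fun i => c.get ⟨(i % c.length).toNat, hlt i⟩, fun i => by simp, fun k => ?_⟩
  simp [Int.emod_eq_of_lt, k.2]

lemma IsIrreducibleConstraint.exists_length_ge {S : Set (List α)}
    (hirr : IsIrreducibleConstraint S) (hne : ∃ w ∈ S, w ≠ []) (n : ℕ) :
    ∃ u ∈ S, n ≤ u.length := by
  obtain ⟨v, hv, hv₀⟩ := hne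
  induction n with
  | zero => exact ⟨v, hv, Nat.zero_le _⟩
  | succ n ih =>
    obtain ⟨u, hu, hn⟩ := ih
    obtain ⟨w, -, huwv⟩ := hirr u hu v hv
    have hpos := List.length_pos_iff.2 hv₀
    exact ⟨_, huwv, by simp only [List.length_append]; omega⟩

/-- Take `u ∈ S` longer than every forbidden word and `w` with `uwu ∈ S`. A forbidden word that
occurs in `…uwuwuw…` also occurs in `uwu`. -/
lemma exists_periodic_of_isFiniteType {S : Set (List α)} (hS : IsFiniteType S)
    (hirr : IsIrreducibleConstraint S) (hne : ∃ w ∈ S, w ≠ []) :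
    ∃ (p : ℕ) (x : ℤ → α), p ≠ 0 ∧ Function.Periodic x p ∧ ∀ i w, ReadsAt x i w → w ∈ S := by
  obtain ⟨F, rfl⟩ := hS
  obtain ⟨u, hu, hlong⟩ := hirr.exists_length_ge hne (F.sup List.length + 1)
  obtain ⟨w, -, huwu⟩ := hirr u hu u hu
  have hpos : 0 < (u ++ w).length := by
    rw [List.length_append]
    omega
  obtain ⟨x, hper, hread⟩ := exists_periodic_readsAt (List.length_pos_iff.1 hpos)
  refine ⟨_, x, hpos.ne', hper, fun i z hz f hf hfz => ?_⟩
  have hu₀ : ReadsAt x (0 + (u ++ w).length) u :=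
    (periodic_readsAt hper u 0).mpr (readsAt_append.1 hread).1
  have huwu₀ : ReadsAt x 0 (u ++ w ++ u) := readsAt_append.2 ⟨hread, hu₀⟩
  obtain ⟨j, hj⟩ := hz.exists_of_isInfix hfz
  have hjmod : ReadsAt x (j % (u ++ w).length) f := by
    rw [Int.emod_def, mul_comm]
    exact ((periodic_readsAt hper f).sub_int_mul_eq _).mpr hj
  have hmod := Int.emod_nonneg j (Int.natCast_pos.2 hpos).ne'
  have hlt := Int.emod_lt_of_pos j (Int.natCast_pos.2 hpos)
  have hlen : f.length ≤ F.sup List.length := Finset.le_sup hf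
  refine huwu f hf (huwu₀.isInfix (j := (j % (u ++ w).length).toNat) ?_ ?_)
  · rwa [zero_add, Int.toNat_of_nonneg hmod]
  · rw [List.length_append (bs := u)]
    omega

end Words

section OrbitMeasure

variable {Ω : Type*} [MeasurableSpace Ω] {T : Ω → Ω} {p : ℕ} {x : Ω}

/-- The uniform distribution on the first `p` points `x, T x, …, T^[p - 1] x` of an orbit, counted
with multiplicity. -/
noncomputable def orbitMeasure (T : Ω → Ω) (p : ℕ) (x : Ω) : Measure Ω :=
  (p : ENNReal)⁻¹ • birkhoffSum T Measure.dirac p x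

lemma isProbabilityMeasure_orbitMeasure (T : Ω → Ω) (hp : p ≠ 0) (x : Ω) :
    IsProbabilityMeasure (orbitMeasure T p x) where
  measure_univ := by
    simp [orbitMeasure, birkhoffSum, ENNReal.inv_mul_cancel, hp]

lemma birkhoffSum_apply_of_isPeriodicPt {M : Type*} [AddCommMonoid M] {X : Type*} {f : X → X}
    {y : X} (hy : Function.IsPeriodicPt f p y) (g : X → M) :
    birkhoffSum f g p (f y) = birkhoffSum f g p y := by
  cases p with
  | zero => rw [birkhoffSum_zero, birkhoffSum_zero]
  | succ p =>
    rw [birkhoffSum_succ, birkhoffSum_succ', ← Function.iterate_succ_apply, hy, add_comm]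

lemma measurePreserving_orbitMeasure (hT : Measurable T) (hx : Function.IsPeriodicPt T p x) :
    MeasurePreserving T (orbitMeasure T p x) (orbitMeasure T p x) := by
  refine ⟨hT, ?_⟩
  have hcomp : ⇑(Measure.mapₗ T) ∘ Measure.dirac = Measure.dirac ∘ T := by
    ext1 y
    simp [Measure.mapₗ_apply_of_measurable hT, Measure.map_dirac' hT]
  rw [orbitMeasure, Measure.map_smul, ← Measure.mapₗ_apply_of_measurable hT, map_birkhoffSum, hcomp]
  rw [← birkhoffSum_apply_of_isPeriodicPt hx Measure.dirac]
  simp_rw [birkhoffSum, Function.comp_apply, ← Function.iterate_succ_apply,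
    Function.iterate_succ_apply']

lemma exists_iterate_mem_of_orbitMeasure_pos {s : Set Ω} (hs : MeasurableSet s)
    (hpos : 0 < orbitMeasure T p x s) : ∃ k, T^[k] x ∈ s := by
  by_contra! hnot
  refine hpos.ne' ?_
  simp [orbitMeasure, birkhoffSum, Measure.dirac_apply' _ hs, hnot]

end OrbitMeasure

section Existence

variable {α : Type*} [MeasurableSpace α]

lemma measurable_shift : Measurable (shift : (ℤ → α) → ℤ → α) :=
  measurable_pi_lambda _ fun _ => measurable_pi_apply _

lemma measurableSet_readsAt [MeasurableSingletonClass α] (i : ℤ) (w : List α) :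
    MeasurableSet {x : ℤ → α | ReadsAt x i w} := by
  simp only [ReadsAt, Set.ofPred_forall]
  exact MeasurableSet.iInter fun k => measurableSet_letter_eq _ _

lemma exists_isAdmissibleInput {K : ℕ} {S : Set (List (Input K))} (hS : IsFiniteType S)
    (hirr : IsIrreducibleConstraint S) (hne : ∃ w ∈ S, w ≠ []) :
    ∃ μ, IsAdmissibleInput S μ := by
  obtain ⟨p, x, hp, hper, hxS⟩ := exists_periodic_of_isFiniteType hS hirr hne
  have hperiodic : Function.IsPeriodicPt shift p x :=
    funext fun i => (shift_iterate p x i).trans (hper i)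
  refine ⟨orbitMeasure shift p x, isProbabilityMeasure_orbitMeasure shift hp x,
    measurePreserving_orbitMeasure measurable_shift hperiodic, ?_⟩
  rintro w ⟨i, hi⟩
  obtain ⟨k, hk⟩ := exists_iterate_mem_of_orbitMeasure_pos (measurableSet_readsAt i w) hi
  exact hxS _ w (readsAt_shift_iterate.1 hk)

end Existence

end ErasureChannel

theorem mainTheorem8_general {K : ℕ} {S : Set (List (ErasureChannel.Input K))}
    (hadm : ∃ μ, ErasureChannel.IsAdmissibleInput S μ) {ν ν₀ : Measure (ℤ → Fin 2)}
    [IsProbabilityMeasure ν] [IsProbabilityMeasure ν₀]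
    (hν : MeasurePreserving ErasureChannel.shift ν ν)
    (hν₀ : MeasurePreserving ErasureChannel.shift ν₀ ν₀)
    {ε : ℝ} (hε : ν.real {e | e 1 = 0} = ε) :
    ErasureChannel.CapacityWellDefined S ν ∧
    ErasureChannel.CapacityWellDefined S ν₀ ∧
    (1 - ε) * ErasureChannel.capacity S ν₀ ≤ ErasureChannel.capacity S ν ∧
    ErasureChannel.capacity S ν ≤ (1 - ε) * Real.log K := by
  rw [← hε, ← ErasureChannel.measureReal_letter_eq_one]
  exact ⟨ErasureChannel.capacityWellDefined hadm hν, ErasureChannel.capacityWellDefined hadm hν₀,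
    ErasureChannel.mul_capacity_le hadm hν hν₀, ErasureChannel.capacity_le hadm hν⟩

theorem mainTheorem8 (K : ℕ) (S : Set (List (ErasureChannel.Input K)))
    (hS : ErasureChannel.IsFiniteType S) (hirr : ErasureChannel.IsIrreducibleConstraint S)
    (hne : ∃ w ∈ S, w ≠ [])
    (ε : ℝ) (ν ν₀ : MeasureTheory.Measure (ℤ → Fin 2))
    (hν : ErasureChannel.IsErasureProcess ν ε)
    (hν₀ : ErasureChannel.IsErasureProcess ν₀ 0) :
    ErasureChannel.CapacityWellDefined S ν ∧
    ErasureChannel.CapacityWellDefined S ν₀ ∧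
    (1 - ε) * ErasureChannel.capacity S ν₀ ≤ ErasureChannel.capacity S ν ∧
    ErasureChannel.capacity S ν ≤ (1 - ε) * Real.log K := by
  have := hν.prob
  have := hν₀.prob
  exact mainTheorem8_general (ErasureChannel.exists_isAdmissibleInput hS hirr hne)
    hν.ergodic.toMeasurePreserving hν₀.ergodic.toMeasurePreserving hν.rate
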